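/- Let $0<\alpha,\beta,\gamma<1$ be fixed and let $P$ be the symmetric matrix with rows and columns indexed by $1,0$ (in this order), $P=\begin{pmatrix}\alpha&\beta\\ \beta&\gamma\end{pmatrix}$, i.e. $P_{1,1}=\alpha$, $P_{1,0}=P_{0,1}=\beta$, $P_{0,0}=\gamma$. The stochastic Kronecker graph $K(n,P)$ is the random simple graph on the vertex set $\mathbb{Z}_2^n$ in which every pair $\{u,v\}$ of distinct vertices is an edge with probability $p_{u,v}=\prod_{i=1}^n P_{u_i,v_i}$, independently of all other pairs. A property holds asymptotically almost surely (a.a.s.) if its probability tends to $1$ as $n\to\infty$. Let $k\ge 3$, let $C_k$ be the cycle of length $k$, and let $X_{C_k}$ be the number of labeled copies of $C_k$ in $K(n,P)$, i.e. the number of injective graph homomorphisms from $C_k$ to $K(n,P)$. **Theorem.** Assume $\alpha=\gamma$. Then the threshold for the appearance of $C_k$ in $K(n,P)$ is $(\alpha+\beta)^k+(\alpha-\beta)^k=1$, that is: * if $(\alpha+\beta)^k+(\alpha-\beta)^k<1$, then a.a.s. $K(n,P)$ contains no copy of $C_k$; * if $(\alpha+\beta)^k+(\alpha-\beta)^k>1$,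 then a.a.s. $K(n,P)$ contains a copy of $C_k$. Additionally, if $(\alpha+\beta)^k+(\alpha-\beta)^k>1$, then a.a.s. $$X_{C_k}=(1+o(1))\left((\alpha+\beta)^k+(\alpha-\beta)^k\right)^n,$$ that is, for every $\varepsilon>0$, a.a.s. $\left|X_{C_k}-\left((\alpha+\beta)^k+(\alpha-\beta)^k\right)^n\right|\le\varepsilon\left((\alpha+\beta)^k+(\alpha-\beta)^k\right)^n$. -/

import Mathlib

open Filter Topology MeasureTheory

/-- The vertex set `ℤ₂ⁿ`: binary strings of length `n`. -/
abbrev BinString (n : ℕ) : Type := Fin n → ZMod 2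

/-- The symmetric matrix `P` with `P 1 1 = α`, `P 1 0 = P 0 1 = β`, `P 0 0 = γ`
(the digit `1` indexes the first row and column). -/
def kroneckerMatrix (α β γ : ℝ) : Matrix (ZMod 2) (ZMod 2) ℝ :=
  Matrix.of fun a b => if a = b then (if a = 1 then α else γ) else β

theorem kroneckerMatrix_symm (α β γ : ℝ) (a b : ZMod 2) :
    kroneckerMatrix α β γ a b = kroneckerMatrix α β γ b a := by
  by_cases h : a = b
  · rw [h]
  · simp [kroneckerMatrix, h, Ne.symm h]

/-- The edge probability `p_{u,v} = ∏ i, P (u i) (v i)`, as a function of the unordered pair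
`{u, v}`. -/
def kroneckerProb (α β γ : ℝ) (n : ℕ) : Sym2 (BinString n) → ℝ :=
  Sym2.lift ⟨fun u v => ∏ i, kroneckerMatrix α β γ (u i) (v i), fun u v =>
    Finset.prod_congr rfl fun i _ => kroneckerMatrix_symm α β γ (u i) (v i)⟩

/-- The Bernoulli law with success probability `p ∈ [0, 1]` on truth values. -/
noncomputable def bernoulliLaw (p : ℝ) : Measure Prop :=
  ENNReal.ofReal p • Measure.dirac True + ENNReal.ofReal (1 - p) • Measure.dirac False

/-- The law of the stochastic Kronecker graph `K(n, P)`: independently for each unordered pair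
`e = {u, v}` of vertices, `e` is selected with probability `p_{u,v}`, and the graph consists of the
selected pairs of distinct vertices (`SimpleGraph.fromEdgeSet` discards the pairs `{u, u}`). -/
noncomputable def stochasticKronecker (α β γ : ℝ) (n : ℕ) :
    Measure (SimpleGraph (BinString n)) :=
  (Measure.pi fun e : Sym2 (BinString n) => bernoulliLaw (kroneckerProb α β γ n e)).map
    fun ω => SimpleGraph.fromEdgeSet {e | ω e}

/-- The property `Q` (of graphs on `ℤ₂ⁿ`, for each `n`) holds asymptotically almost surely in
`K(n, P)`: its probability tends to one as `n → ∞`. -/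
def KroneckerAas (α β γ : ℝ) (Q : ∀ n : ℕ, SimpleGraph (BinString n) → Prop) : Prop :=
  Tendsto (fun n : ℕ => stochasticKronecker α β γ n {G | Q n G}) atTop (𝓝 1)

/-!
The expected number of labelled `k`-cycles is the total weight of the injective closed walks for
the `n`-th tensor power of `P`. Dropping injectivity makes the sum multiplicative over the digits,
hence equal to `λ ^ n` with `λ = tr (P ^ k)`; when `α = γ` the matrix `P` is a convolution operator
on `ZMod 2`, and its characters give `λ = (α + β) ^ k + (α - β) ^ k`. A coincidence `φ i = φ j`
costs a constant factor in every digit, so non-injective walks are exponentially negligible.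
Markov's inequality settles `λ < 1`.

For `λ > 1`, the variance is bounded by a sum over pairs of cycles sharing a nonempty edge set `H`.
The shared edges may sit at different positions, and in different directions, on the two cycles. A
cycle is therefore labelled by its positions at the vertices of a fixed walk through `H`; there are
at most `k ^ k` labels, so Cauchy–Schwarz reduces to pairs of equally labelled cycles at the cost
of a factor `k ^ k`, and those agree at every position of `H`. The total weight of the pairs that
agree on a set `I` of positions is again an `n`-th power. Its base is bounded by a sum over the
characters of `ZMod 2 × ZMod 2`, once agreement of the vertices is relaxed to agreement of the
steps, and weighted AM–GM shows that it is less than `λ ^ 2`. Chebyshev's inequality concludes.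
-/

theorem partialSum_last {M : Type*} [AddCommMonoid M] {n : ℕ} (t : Fin n → M) :
    Fin.partialSum t (Fin.last n) = ∑ i, t i := by
  rw [Fin.partialSum, Fin.val_last, List.take_of_length_le (List.length_ofFn).le, List.sum_ofFn]

theorem partialSum_add_one_sub {A : Type*} [AddCommGroup A] {m : ℕ} {t : Fin (m + 1) → A}
    (ht : ∑ i, t i = 0) (i : Fin (m + 1)) :
    Fin.partialSum t (i + 1).castSucc - Fin.partialSum t i.castSucc = t i := by
  induction i using Fin.lastCases with
  | last =>
    have total : Fin.partialSum t (Fin.last m).castSucc + t (Fin.last m) = 0 := by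
      rw [← Fin.partialSum_succ, Fin.succ_last, partialSum_last, ht]
    rw [Fin.last_add_one, Fin.castSucc_zero, Fin.partialSum_zero, zero_sub,
      neg_eq_of_add_eq_zero_right total]
  | cast i =>
    rw [Fin.coeSucc_eq_succ, ← Fin.succ_castSucc, Fin.partialSum_succ, add_sub_cancel_left]

theorem eq_of_increments_eq {A : Type*} [AddGroup A] {m : ℕ} {y z : Fin (m + 1) → A}
    (h0 : y 0 = z 0) (h : ∀ i, y (i + 1) - y i = z (i + 1) - z i) : y = z := by
  funext i
  induction i using Fin.induction with
  | zero => exact h0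
  | succ i ih => simpa [Fin.coeSucc_eq_succ, ih] using h i.castSucc

theorem sum_increments_eq_zero {A : Type*} [AddCommGroup A] {k : ℕ} [NeZero k] (z : Fin k → A) :
    ∑ i, (z (i + 1) - z i) = 0 := by
  rw [Finset.sum_sub_distrib, sub_eq_zero]
  exact Equiv.sum_comp (Equiv.addRight 1) z

theorem sum_comp_increments {A M : Type*} [AddCommGroup A] [Fintype A] [DecidableEq A]
    [AddCommMonoid M] (k : ℕ) [NeZero k] (F : (Fin k → A) → M) :
    ∑ z : Fin k → A, F (fun i => z (i + 1) - z i) =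
      Fintype.card A • ∑ t : Fin k → A with ∑ i, t i = 0, F t := by
  obtain ⟨m, rfl⟩ := Nat.exists_eq_succ_of_ne_zero (NeZero.ne k)
  rw [← Finset.card_univ, ← Finset.sum_const, ← Finset.sum_product']
  refine Finset.sum_bij' (fun z _ => (z 0, fun i => z (i + 1) - z i))
    (fun x _ i => x.1 + Fin.partialSum x.2 i.castSucc) ?_ (by simp) ?_ ?_ (by simp)
  · intro z _
    simpa only [Finset.mem_product, Finset.mem_univ, Finset.mem_filter, true_and]
      using sum_increments_eq_zero z
  · intro z _
    refine eq_of_increments_eq (by simp) fun i => ?_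
    rw [add_sub_add_left_eq_sub, partialSum_add_one_sub (sum_increments_eq_zero z)]
  · rintro ⟨a, t⟩ h
    have ht : ∑ i, t i = 0 := (Finset.mem_filter.1 (Finset.mem_product.1 h).2).2
    simp [partialSum_add_one_sub ht]

/-- The Fourier coefficient of `f` at the character `t ↦ ψ (t * c)`. -/
def charSum {A R : Type*} [CommRing A] [Fintype A] [CommRing R] (ψ : AddChar A R) (f : A → R)
    (c : A) : R := ∑ t, f t * ψ (t * c)

theorem sum_prod_increments_eq_sum_prod_charSum {A R : Type*} [CommRing A] [Fintype A]
    [CommRing R] [IsDomain R] {ψ : AddChar A R} (hψ : ψ.IsPrimitive)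
    (k : ℕ) [NeZero k] (f : Fin k → A → R) :
    ∑ z : Fin k → A, ∏ i, f i (z (i + 1) - z i) =
      ∑ c, ∏ i, charSum ψ (f i) c := by
  classical
  have orthogonality (s : A) : ∑ c, ψ (s * c) = if s = 0 then (Fintype.card A : R) else 0 := by
    simp_rw [mul_comm s, AddChar.sum_mulShift s hψ, Nat.cast_ite, Nat.cast_zero]
  have char_sum (t : Fin k → A) (c : A) : ψ ((∑ i, t i) * c) = ∏ i, ψ (t i * c) := by
    rw [Finset.sum_mul]
    exact map_prod ψ.toMonoidHom (fun i => Multiplicative.ofAdd (t i * c)) Finset.univ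
  calc ∑ z : Fin k → A, ∏ i, f i (z (i + 1) - z i)
      = ∑ t : Fin k → A, (∏ i, f i (t i)) * ∑ c, ψ ((∑ i, t i) * c) := by
        rw [sum_comp_increments k fun t => ∏ i, f i (t i), Finset.sum_filter, nsmul_eq_mul,
          Finset.mul_sum]
        refine Finset.sum_congr rfl fun t _ => ?_
        rw [orthogonality, mul_ite, mul_ite, mul_zero, mul_zero, mul_comm]
    _ = ∑ c, ∑ t : Fin k → A, ∏ i, f i (t i) * ψ (t i * c) := by
        simp_rw [Finset.mul_sum, char_sum, ← Finset.prod_mul_distrib]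
        exact Finset.sum_comm
    _ = ∑ c, ∏ i, charSum ψ (f i) c := by
        simp_rw [charSum, Finset.prod_univ_sum, Fintype.piFinset_univ]

theorem sum_prod_digits {V R : Type*} [Fintype V] [CommSemiring R] {k : ℕ} (n : ℕ)
    (g : (Fin k → V) → R) :
    ∑ φ : Fin k → Fin n → V, ∏ l, g (fun i => φ i l) = (∑ x, g x) ^ n := by
  rw [Fintype.sum_pow]
  exact Fintype.sum_equiv (Equiv.piComm _) _ _ fun _ => rfl

theorem sum_sum_prod_digits {V R : Type*} [Fintype V] [CommSemiring R] {k : ℕ} (n : ℕ)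
    (g : (Fin k → V) → (Fin k → V) → R) :
    ∑ φ : Fin k → Fin n → V, ∑ ψ : Fin k → Fin n → V,
      ∏ l, g (fun i => φ i l) (fun i => ψ i l) = (∑ x, ∑ y, g x y) ^ n := by
  simp_rw [← Fintype.sum_prod_type', Fintype.sum_pow]
  exact Fintype.sum_equiv (((Equiv.piComm _).prodCongr (Equiv.piComm _)).trans
    (Equiv.arrowProdEquivProdArrow (Fin n) _ _).symm) _ _ fun _ => rfl

section Weights

variable {V R : Type*} [CommSemiring R] {k : ℕ} [NeZero k]

/-- The weight of the closed walk `φ 0, φ 1, …, φ (k - 1), φ 0`, where `w u v` is the weight of a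
step from `u` to `v`. -/
def closedWalkWeight (w : V → V → R) (φ : Fin k → V) : R := ∏ i, w (φ i) (φ (i + 1))

/-- Two closed walks make the same steps at the times in `I`. -/
def AgreeOn (I : Finset (Fin k)) (φ ψ : Fin k → V) : Prop :=
  ∀ i ∈ I, φ i = ψ i ∧ φ (i + 1) = ψ (i + 1)

instance [DecidableEq V] (I : Finset (Fin k)) (φ ψ : Fin k → V) : Decidable (AgreeOn I φ ψ) :=
  inferInstanceAs (Decidable (∀ i ∈ I, φ i = ψ i ∧ φ (i + 1) = ψ (i + 1)))

/-- The weight of a pair of closed walks that are required to agree on `I`, where the steps in `I`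
are counted only once. -/
def overlapWeight [DecidableEq V] (w : V → V → R) (I : Finset (Fin k)) (φ ψ : Fin k → V) : R :=
  if AgreeOn I φ ψ then closedWalkWeight w φ * ∏ i ∈ Iᶜ, w (ψ i) (ψ (i + 1)) else 0

variable (k) in
/-- The total weight of the closed walks of length `k`, that is, the trace of the `k`-th power of
the matrix `w`. -/
def closedWalkSum [Fintype V] (w : V → V → R) : R := ∑ φ : Fin k → V, closedWalkWeight w φ

/-- The total weight of the closed walks that are in the same place at the times `i` and `j`. -/
def coincidenceSum [Fintype V] [DecidableEq V] (w : V → V → R) (i j : Fin k) : R :=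
  ∑ φ : Fin k → V with φ i = φ j, closedWalkWeight w φ

/-- The total weight of the pairs of closed walks that agree on `I`. -/
def overlapSum [Fintype V] [DecidableEq V] (w : V → V → R) (I : Finset (Fin k)) : R :=
  ∑ φ : Fin k → V, ∑ ψ : Fin k → V, overlapWeight w I φ ψ

/-- The `n`-th tensor power of the weight `w`. -/
def tensorPower (w : V → V → R) (n : ℕ) (u v : Fin n → V) : R := ∏ l, w (u l) (v l)

theorem closedWalkWeight_tensorPower (w : V → V → R) (n : ℕ) (φ : Fin k → Fin n → V) :
    closedWalkWeight (tensorPower w n) φ = ∏ l, closedWalkWeight w fun i => φ i l :=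
  Finset.prod_comm

theorem agreeOn_iff_forall_digit {n : ℕ} {I : Finset (Fin k)} {φ ψ : Fin k → Fin n → V} :
    AgreeOn I φ ψ ↔ ∀ l, AgreeOn I (fun i => φ i l) fun i => ψ i l := by
  simp only [AgreeOn, funext_iff, ← forall_and]
  exact ⟨fun h l i hi => h i hi l, fun h i hi l => h l i hi⟩

theorem overlapWeight_tensorPower [DecidableEq V] (w : V → V → R) (n : ℕ) (I : Finset (Fin k))
    (φ ψ : Fin k → Fin n → V) :
    overlapWeight (tensorPower w n) I φ ψ =
      ∏ l, overlapWeight w I (fun i => φ i l) fun i => ψ i l := by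
  simp only [overlapWeight, closedWalkWeight_tensorPower, agreeOn_iff_forall_digit,
    Finset.prod_ite_zero, Finset.prod_mul_distrib, Finset.mem_univ, forall_const]
  simp only [tensorPower, Finset.prod_comm (s := Iᶜ)]

theorem closedWalkSum_tensorPower [Fintype V] (w : V → V → R) (n : ℕ) :
    closedWalkSum k (tensorPower w n) = closedWalkSum k w ^ n := by
  simp_rw [closedWalkSum, closedWalkWeight_tensorPower, sum_prod_digits]

theorem coincidenceSum_tensorPower [Fintype V] [DecidableEq V] (w : V → V → R) (n : ℕ)
    (i j : Fin k) :
    coincidenceSum (tensorPower w n) i j = coincidenceSum w i j ^ n := by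
  simp_rw [coincidenceSum, Finset.sum_filter, ← sum_prod_digits, Finset.prod_ite_zero,
    closedWalkWeight_tensorPower, funext_iff, Finset.mem_univ, forall_const]

theorem overlapSum_tensorPower [Fintype V] [DecidableEq V] (w : V → V → R) (n : ℕ)
    (I : Finset (Fin k)) :
    overlapSum (tensorPower w n) I = overlapSum w I ^ n := by
  simp_rw [overlapSum, overlapWeight_tensorPower]
  exact sum_sum_prod_digits n (overlapWeight w I)

theorem closedWalkWeight_nonneg [PartialOrder R] [IsOrderedRing R] {w : V → V → R}
    (hw : ∀ u v, 0 ≤ w u v) (φ : Fin k → V) : 0 ≤ closedWalkWeight w φ :=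
  Finset.prod_nonneg fun _ _ => hw _ _

theorem overlapWeight_nonneg [PartialOrder R] [IsOrderedRing R] [DecidableEq V] {w : V → V → R}
    (hw : ∀ u v, 0 ≤ w u v) (I : Finset (Fin k)) (φ ψ : Fin k → V) :
    0 ≤ overlapWeight w I φ ψ := by
  unfold overlapWeight
  split_ifs
  · exact mul_nonneg (closedWalkWeight_nonneg hw φ) (Finset.prod_nonneg fun _ _ => hw _ _)
  · exact le_rfl

theorem coincidenceSum_lt_closedWalkSum [PartialOrder R] [IsStrictOrderedRing R] [Fintype V]
    [DecidableEq V] [Nontrivial V] {w : V → V → R} (hw : ∀ u v, 0 < w u v) {i j : Fin k}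
    (hij : i ≠ j) : coincidenceSum w i j < closedWalkSum k w := by
  obtain ⟨u, v, huv⟩ := exists_pair_ne V
  have weight_pos (φ : Fin k → V) : 0 < closedWalkWeight w φ := Finset.prod_pos fun _ _ => hw _ _
  refine Finset.sum_lt_sum_of_subset (Finset.filter_subset _ _)
    (i := Function.update (fun _ => v) i u) (Finset.mem_univ _) ?_ (weight_pos _)
    fun φ _ _ => (weight_pos φ).le
  simp [Function.update_of_ne hij.symm, huv]

end Weights

section Characters

variable {A R : Type*} [CommRing A] [Fintype A] [CommRing R]

theorem closedWalkSum_eq_sum_charSum_pow [IsDomain R] {ψ : AddChar A R} (hψ : ψ.IsPrimitive)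
    (k : ℕ) [NeZero k] (f : A → R) :
    closedWalkSum k (fun a b => f (b - a)) = ∑ c, charSum ψ f c ^ k := by
  simp_rw [closedWalkSum, closedWalkWeight,
    sum_prod_increments_eq_sum_prod_charSum hψ k fun _ => f, charSum, Finset.prod_const,
    Finset.card_univ, Fintype.card_fin]

/-- The character `(a, b) ↦ ψ a * ψ b`. -/
def pairChar {A R : Type*} [AddMonoid A] [CommMonoid R] (ψ : AddChar A R) : AddChar (A × A) R :=
  ψ.compAddMonoidHom (AddMonoidHom.fst A A) * ψ.compAddMonoidHom (AddMonoidHom.snd A A)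

theorem pairChar_isPrimitive {A R : Type*} [CommRing A] [CommMonoid R] {ψ : AddChar A R}
    (hψ : ψ.IsPrimitive) : (pairChar ψ).IsPrimitive := by
  rintro ⟨a, b⟩ hab h
  have trivial_at (x y : A) : ψ (a * x) * ψ (b * y) = 1 := DFunLike.congr_fun h (x, y)
  have ha : a = 0 := by
    by_contra ha
    exact hψ ha (DFunLike.ext _ _ fun x => by simpa using trivial_at x 0)
  have hb : b = 0 := by
    by_contra hb
    exact hψ hb (DFunLike.ext _ _ fun y => by simpa using trivial_at 0 y)
  exact hab (by rw [ha, hb, Prod.mk_zero_zero])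

/-- The weight of a simultaneous step of two walks: the steps are either counted separately, or
required to agree and counted once. -/
def pairStepWeight {A R : Type*} [DecidableEq A] [MulZeroClass R] (f : A → R) (shared : Prop)
    [Decidable shared] (t : A × A) : R :=
  if shared then if t.1 = t.2 then f t.1 else 0 else f t.1 * f t.2

theorem charSum_pairStepWeight_of_shared [DecidableEq A] (ψ : AddChar A R) (f : A → R)
    {shared : Prop} [Decidable shared] (h : shared) (c : A × A) :
    charSum (pairChar ψ) (pairStepWeight f shared) c = charSum ψ f (c.1 + c.2) := by
  have pairChar_mul (t : A × A) : pairChar ψ (t * c) = ψ (t.1 * c.1) * ψ (t.2 * c.2) := rfl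
  simp [charSum, pairStepWeight, h, Fintype.sum_prod_type, pairChar_mul, mul_add,
    AddChar.map_add_eq_mul]

theorem charSum_pairStepWeight_of_not_shared [DecidableEq A] (ψ : AddChar A R) (f : A → R)
    {shared : Prop} [Decidable shared] (h : ¬shared) (c : A × A) :
    charSum (pairChar ψ) (pairStepWeight f shared) c = charSum ψ f c.1 * charSum ψ f c.2 := by
  have pairChar_mul (t : A × A) : pairChar ψ (t * c) = ψ (t.1 * c.1) * ψ (t.2 * c.2) := rfl
  simp only [charSum, pairStepWeight, h, if_false, Fintype.sum_prod_type, pairChar_mul,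
    Finset.sum_mul_sum, mul_mul_mul_comm]

theorem sum_prod_pairStepWeight [DecidableEq A] [IsDomain R] {ψ : AddChar A R}
    (hψ : ψ.IsPrimitive) {k : ℕ} [NeZero k] (f : A → R) (I : Finset (Fin k)) :
    ∑ z : Fin k → A × A, ∏ i, pairStepWeight f (i ∈ I) (z (i + 1) - z i) =
      ∑ c : A × A, charSum ψ f (c.1 + c.2) ^ I.card *
        (charSum ψ f c.1 * charSum ψ f c.2) ^ Iᶜ.card := by
  rw [sum_prod_increments_eq_sum_prod_charSum (pairChar_isPrimitive hψ) k
    fun i => pairStepWeight f (i ∈ I)]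
  refine Finset.sum_congr rfl fun c _ => ?_
  rw [← Finset.prod_mul_prod_compl I,
    Finset.prod_congr rfl fun i hi => charSum_pairStepWeight_of_shared ψ f hi c,
    Finset.prod_congr rfl fun i hi =>
      charSum_pairStepWeight_of_not_shared ψ f (Finset.mem_compl.1 hi) c,
    Finset.prod_const, Finset.prod_const]

end Characters

theorem card_nsmul_sum_pinned {ι A M : Type*} [AddGroup A] [Fintype A] [AddCommMonoid M]
    [Fintype (ι → A)] [DecidableEq A]
    {W : (ι → A) → M} (hW : ∀ y a, W (fun i => y i + a) = W y) (i₀ : ι) (b : A) :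
    Fintype.card A • ∑ y with b = y i₀, W y = ∑ y, W y := by
  have translate (a : A) : ∑ y with y i₀ = a, W y = ∑ y with b = y i₀, W y := by
    refine Finset.sum_equiv (Equiv.addRight fun _ => -a + b) (fun y => ?_) fun y _ => (hW y _).symm
    simp [eq_comm, ← add_assoc, add_neg_eq_zero]
  rw [← Finset.sum_fiberwise Finset.univ fun y => y i₀]
  simp_rw [translate, Finset.sum_const, Finset.card_univ]

theorem pairStepWeight_nonneg {A R : Type*} [DecidableEq A] [Semiring R] [PartialOrder R]
    [IsOrderedRing R] {f : A → R} (hf : ∀ t, 0 ≤ f t) (shared : Prop) [Decidable shared]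
    (t : A × A) : 0 ≤ pairStepWeight f shared t := by
  unfold pairStepWeight
  split_ifs
  exacts [hf _, le_rfl, mul_nonneg (hf _) (hf _)]

theorem overlapWeight_le_prod_pairStepWeight {A R : Type*} [AddGroup A] [DecidableEq A]
    [CommSemiring R] [PartialOrder R] [IsOrderedRing R] {f : A → R} (hf : ∀ t, 0 ≤ f t) {k : ℕ}
    [NeZero k] (I : Finset (Fin k)) (φ ψ : Fin k → A) :
    overlapWeight (fun a b => f (b - a)) I φ ψ ≤
      ∏ i, pairStepWeight f (i ∈ I) (φ (i + 1) - φ i, ψ (i + 1) - ψ i) := by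
  unfold overlapWeight
  split_ifs with h
  · rw [closedWalkWeight, ← Finset.prod_mul_prod_compl I, ← Finset.prod_mul_prod_compl I,
      mul_assoc, ← Finset.prod_mul_distrib]
    refine le_of_eq (congrArg₂ _ ?_ ?_)
    · refine Finset.prod_congr rfl fun i hi => ?_
      obtain ⟨h1, h2⟩ := h i hi
      simp [pairStepWeight, hi, h1, h2]
    · refine Finset.prod_congr rfl fun i hi => ?_
      simp [pairStepWeight, Finset.mem_compl.1 hi]
  · exact Finset.prod_nonneg fun _ _ => pairStepWeight_nonneg hf _ _

theorem card_mul_overlapSum_le {A R : Type*} [AddGroup A] [Fintype A] [DecidableEq A]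
    [CommSemiring R] [PartialOrder R] [IsOrderedRing R] {f : A → R} (hf : ∀ t, 0 ≤ f t) {k : ℕ}
    [NeZero k] {I : Finset (Fin k)} (hI : I.Nonempty) :
    Fintype.card A * overlapSum (fun a b => f (b - a)) I ≤
      ∑ z : Fin k → A × A, ∏ i, pairStepWeight f (i ∈ I) (z (i + 1) - z i) := by
  obtain ⟨i₀, hi₀⟩ := hI
  rw [← Equiv.sum_comp (Equiv.arrowProdEquivProdArrow (Fin k) (fun _ => A) fun _ => A).symm,
    Fintype.sum_prod_type, overlapSum, Finset.mul_sum]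
  refine Finset.sum_le_sum fun φ _ => ?_
  set W : (Fin k → A) → R := fun ψ =>
    ∏ i, pairStepWeight f (i ∈ I) (φ (i + 1) - φ i, ψ (i + 1) - ψ i)
  calc Fintype.card A * ∑ ψ, overlapWeight (fun a b => f (b - a)) I φ ψ
      = Fintype.card A • ∑ ψ with φ i₀ = ψ i₀, overlapWeight (fun a b => f (b - a)) I φ ψ := by
        rw [nsmul_eq_mul, Finset.sum_filter_of_ne]
        intro ψ _ hψ
        by_contra h
        exact hψ (if_neg fun agree => h (agree i₀ hi₀).1)
    _ ≤ Fintype.card A • ∑ ψ with φ i₀ = ψ i₀, W ψ :=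
        nsmul_le_nsmul_right
          (Finset.sum_le_sum fun ψ _ => overlapWeight_le_prod_pairStepWeight hf I φ ψ) _
    _ = ∑ ψ, W ψ := card_nsmul_sum_pinned (by simp [W]) i₀ (φ i₀)

theorem weighted_am_gm_pow {a b : ℝ} (ha : 0 ≤ a) (hb : 0 ≤ b) (s t : ℕ) :
    (s + t) * (a ^ s * b ^ t) ≤ s * a ^ (s + t) + t * b ^ (s + t) := by
  rcases (Nat.cast_nonneg (α := ℝ) (s + t)).eq_or_lt' with hst | hst
  · obtain ⟨rfl, rfl⟩ : s = 0 ∧ t = 0 := Nat.add_eq_zero_iff.1 (Nat.cast_eq_zero.1 hst)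
    simp
  push_cast at hst
  have root {c : ℝ} (hc : 0 ≤ c) (r : ℕ) : (c ^ (s + t)) ^ ((r : ℝ) / (s + t)) = c ^ r := by
    rw [← Real.rpow_natCast_mul hc, Nat.cast_add, mul_div_cancel₀ _ hst.ne', Real.rpow_natCast]
  have am_gm := Real.geom_mean_le_arith_mean2_weighted
    (w₁ := (s : ℝ) / (s + t)) (w₂ := (t : ℝ) / (s + t)) (by positivity) (by positivity)
    (pow_nonneg ha (s + t)) (pow_nonneg hb (s + t)) (by rw [← add_div, div_self hst.ne'])
  rw [root ha, root hb] at am_gm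
  calc (s + t) * (a ^ s * b ^ t)
      ≤ (s + t) * (s / (s + t) * a ^ (s + t) + t / (s + t) * b ^ (s + t)) :=
        mul_le_mul_of_nonneg_left am_gm hst.le
    _ = s * a ^ (s + t) + t * b ^ (s + t) := by field_simp

theorem neg_one_lt_pow {D : ℝ} (hD : -1 < D) {k : ℕ} (hk : k ≠ 0) : -1 < D ^ k := by
  rcases le_or_gt 0 D with h | h
  · exact neg_one_lt_zero.trans_le (pow_nonneg h k)
  · refine (abs_lt.1 ?_).1
    rw [abs_pow]
    exact pow_lt_one₀ (abs_nonneg D) (abs_lt.2 ⟨hD, h.trans one_pos⟩) hk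

theorem overlap_bound_lt {S D : ℝ} (hS : 0 ≤ S) (hD : -1 < D) {s t : ℕ} (hst : s + t ≠ 0)
    (hlam : 1 < S ^ (s + t) + D ^ (s + t)) :
    S ^ s * (S ^ 2) ^ t + 2 * (D ^ s * (S * D) ^ t) + S ^ s * (D ^ 2) ^ t <
      2 * (S ^ (s + t) + D ^ (s + t)) ^ 2 := by
  set A := S ^ (s + t) with hA
  set B := D ^ (s + t) with hB
  have hB1 : -1 < B := neg_one_lt_pow hD hst
  have hst' : (0 : ℝ) < s + t := by exact_mod_cast Nat.pos_of_ne_zero hst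
  have first_terms : S ^ s * (S ^ 2) ^ t + 2 * (D ^ s * (S * D) ^ t) = S ^ t * (A + 2 * B) := by
    rw [hA, hB]; ring
  have first_bound : (s + t) * S ^ t ≤ s + t * A := by
    simpa using weighted_am_gm_pow zero_le_one hS s t
  have last_bound : (s + t) * (S ^ s * (D ^ 2) ^ t) ≤ s * A + t * B ^ 2 := by
    simpa only [hB, ← pow_mul, mul_comm 2] using weighted_am_gm_pow hS (sq_nonneg D) s t
  refine lt_of_mul_lt_mul_left ?_ hst'.le
  calc (s + t) * (S ^ s * (S ^ 2) ^ t + 2 * (D ^ s * (S * D) ^ t) + S ^ s * (D ^ 2) ^ t)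
      = (s + t) * S ^ t * (A + 2 * B) + (s + t) * (S ^ s * (D ^ 2) ^ t) := by
        rw [first_terms]; ring
    _ ≤ (s + t * A) * (A + 2 * B) + (s * A + t * B ^ 2) :=
        add_le_add (mul_le_mul_of_nonneg_right first_bound (by linarith)) last_bound
    _ = s * (2 * (A + B)) + t * (A + B) ^ 2 := by ring
    _ ≤ s * max (2 * (A + B)) ((A + B) ^ 2) + t * max (2 * (A + B)) ((A + B) ^ 2) := by
        gcongr
        exacts [le_max_left _ _, le_max_right _ _]
    _ = (s + t) * max (2 * (A + B)) ((A + B) ^ 2) := by ring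
    _ < (s + t) * (2 * (A + B) ^ 2) :=
        mul_lt_mul_of_pos_left (max_lt (by nlinarith) (by nlinarith)) hst'

section Digits

/-- The nontrivial character of `ZMod 2`. -/
noncomputable def signChar : AddChar (ZMod 2) ℝ := AddChar.zmodChar 2 (ζ := -1) (by norm_num)

theorem signChar_isPrimitive : signChar.IsPrimitive :=
  AddChar.zmodChar_primitive_of_primitive_root 2 (IsPrimitiveRoot.neg_one 0 (by norm_num))

/-- The weight of a step `t` in `ZMod 2`: `α` for no change and `β` for a change of digit. -/
def stepWeight (α β : ℝ) (t : ZMod 2) : ℝ := if t = 0 then α else β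

theorem kroneckerMatrix_eq_stepWeight (α β : ℝ) :
    kroneckerMatrix α β α = fun a b => stepWeight α β (b - a) := by
  ext a b
  by_cases h : a = b
  · simp [kroneckerMatrix, stepWeight, h]
  · simp [kroneckerMatrix, stepWeight, h, sub_eq_zero, Ne.symm h]

theorem sum_zmod_two {M : Type*} [AddCommMonoid M] (f : ZMod 2 → M) : ∑ a, f a = f 0 + f 1 :=
  Fin.sum_univ_two f

theorem charSum_stepWeight_zero (α β : ℝ) : charSum signChar (stepWeight α β) 0 = α + β := by
  simp [charSum, stepWeight, sum_zmod_two]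

theorem charSum_stepWeight_one (α β : ℝ) : charSum signChar (stepWeight α β) 1 = α - β := by
  simp [charSum, stepWeight, sum_zmod_two, signChar, AddChar.zmodChar_apply, ZMod.val_one,
    sub_eq_add_neg]

theorem closedWalkSum_kroneckerMatrix (k : ℕ) [NeZero k] (α β : ℝ) :
    closedWalkSum k (kroneckerMatrix α β α) = (α + β) ^ k + (α - β) ^ k := by
  rw [kroneckerMatrix_eq_stepWeight, closedWalkSum_eq_sum_charSum_pow signChar_isPrimitive,
    sum_zmod_two, charSum_stepWeight_zero, charSum_stepWeight_one]

theorem two_mul_overlapSum_kroneckerMatrix_le {α β : ℝ} (hα : 0 ≤ α) (hβ : 0 ≤ β) {k : ℕ}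
    [NeZero k] {I : Finset (Fin k)} (hI : I.Nonempty) :
    2 * overlapSum (kroneckerMatrix α β α) I ≤
      (α + β) ^ I.card * ((α + β) ^ 2) ^ Iᶜ.card +
        2 * ((α - β) ^ I.card * ((α + β) * (α - β)) ^ Iᶜ.card) +
        (α + β) ^ I.card * ((α - β) ^ 2) ^ Iᶜ.card := by
  have stepWeight_nonneg (t : ZMod 2) : 0 ≤ stepWeight α β t := by
    unfold stepWeight
    split_ifs <;> assumption
  have one_add_one : (1 : ZMod 2) + 1 = 0 := rfl
  have bound := card_mul_overlapSum_le stepWeight_nonneg hI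
  simp only [sum_prod_pairStepWeight signChar_isPrimitive, Fintype.sum_prod_type, sum_zmod_two,
    add_zero, zero_add, one_add_one, charSum_stepWeight_zero, charSum_stepWeight_one,
    ← kroneckerMatrix_eq_stepWeight, ZMod.card] at bound
  rw [mul_comm (α - β) (α + β), ← sq, ← sq] at bound
  norm_num at bound
  linarith

theorem overlapSum_kroneckerMatrix_lt {α β : ℝ} (hα : 0 < α) (hβ : 0 ≤ β) (hβ1 : β ≤ 1) {k : ℕ}
    [NeZero k] (supercritical : 1 < closedWalkSum k (kroneckerMatrix α β α)) {I : Finset (Fin k)}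
    (hI : I.Nonempty) :
    overlapSum (kroneckerMatrix α β α) I < closedWalkSum k (kroneckerMatrix α β α) ^ 2 := by
  rw [closedWalkSum_kroneckerMatrix] at supercritical ⊢
  have card_eq : I.card + Iᶜ.card = k := (Finset.card_add_card_compl I).trans (Fintype.card_fin k)
  have digit_bound := overlap_bound_lt (S := α + β) (D := α - β) (by positivity) (by linarith)
    (card_eq.trans_ne (NeZero.ne k)) (by rwa [card_eq])
  rw [card_eq] at digit_bound
  linarith [two_mul_overlapSum_kroneckerMatrix_le hα.le hβ hI]

theorem kroneckerMatrix_mem_of_mem {s : Set ℝ} {α β γ : ℝ} (hα : α ∈ s) (hβ : β ∈ s) (hγ : γ ∈ s)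
    (a b : ZMod 2) : kroneckerMatrix α β γ a b ∈ s := by
  simp only [kroneckerMatrix, Matrix.of_apply]
  split_ifs <;> assumption

end Digits

theorem sq_sum_le_card_mul_sum_same_label {ι κ : Type*} [Fintype κ] [DecidableEq κ]
    (s : Finset ι) (c : ι → κ) (a : ι → ℝ) :
    (∑ x ∈ s, a x) ^ 2 ≤ Fintype.card κ * ∑ x ∈ s, ∑ y ∈ s with c x = c y, a x * a y := by
  calc (∑ x ∈ s, a x) ^ 2
      = (∑ l, ∑ x ∈ s with c x = l, a x) ^ 2 := by rw [Finset.sum_fiberwise]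
    _ ≤ Fintype.card κ * ∑ l, (∑ x ∈ s with c x = l, a x) ^ 2 := sq_sum_le_card_mul_sum_sq
    _ = Fintype.card κ * ∑ l, ∑ x ∈ s with c x = l, ∑ y ∈ s with c x = c y, a x * a y := by
        refine congrArg _ (Finset.sum_congr rfl fun l _ => ?_)
        rw [sq, Finset.sum_mul_sum]
        refine Finset.sum_congr rfl fun x hx => ?_
        simp_rw [(Finset.mem_filter.1 hx).2, eq_comm]
    _ = Fintype.card κ * ∑ x ∈ s, ∑ y ∈ s with c x = c y, a x * a y := by
        rw [Finset.sum_fiberwise]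

section SetSystem

variable {ι E : Type*} [DecidableEq E]

theorem prod_union_eq {M : Type*} [CommMonoid M] (p : E → M) (s t : Finset E) :
    ∏ e ∈ s ∪ t, p e =
      (∏ e ∈ s ∩ t, p e) * ((∏ e ∈ s \ (s ∩ t), p e) * ∏ e ∈ t \ (s ∩ t), p e) := by
  rw [← Finset.sdiff_union_self_eq_union, Finset.prod_union Finset.sdiff_disjoint,
    ← Finset.prod_sdiff (Finset.inter_subset_right (s₁ := s) (s₂ := t)),
    Finset.sdiff_inter_self_left]
  ac_rfl

theorem sum_prod_union_le [Fintype E] {p : E → ℝ} (hp : ∀ e, 0 ≤ p e) (s : Finset ι)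
    (S : ι → Finset E) :
    ∑ x ∈ s ×ˢ s with ¬Disjoint (S x.1) (S x.2), ∏ e ∈ S x.1 ∪ S x.2, p e ≤
      ∑ H : Finset E with H.Nonempty,
        (∏ e ∈ H, p e) * (∑ a ∈ s with H ⊆ S a, ∏ e ∈ S a \ H, p e) ^ 2 := by
  have prod_nonneg (T : Finset E) : 0 ≤ ∏ e ∈ T, p e := Finset.prod_nonneg fun _ _ => hp _
  set g : Finset E → ι × ι → ℝ := fun H x =>
    (∏ e ∈ H, p e) * ((∏ e ∈ S x.1 \ H, p e) * ∏ e ∈ S x.2 \ H, p e)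
  have g_nonneg (H : Finset E) (x : ι × ι) : 0 ≤ g H x :=
    mul_nonneg (prod_nonneg _) (mul_nonneg (prod_nonneg _) (prod_nonneg _))
  calc ∑ x ∈ s ×ˢ s with ¬Disjoint (S x.1) (S x.2), ∏ e ∈ S x.1 ∪ S x.2, p e
      ≤ ∑ x ∈ s ×ˢ s with ¬Disjoint (S x.1) (S x.2),
          ∑ H with H.Nonempty ∧ H ⊆ S x.1 ∩ S x.2, g H x := by
        refine Finset.sum_le_sum fun x hx => ?_
        have meet : (S x.1 ∩ S x.2).Nonempty :=
          Finset.not_disjoint_iff_nonempty_inter.1 (Finset.mem_filter.1 hx).2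
        rw [prod_union_eq]
        exact Finset.single_le_sum (f := fun H => g H x) (fun H _ => g_nonneg H x)
          (by simpa using meet)
    _ ≤ ∑ x ∈ s ×ˢ s, ∑ H with H.Nonempty ∧ H ⊆ S x.1 ∩ S x.2, g H x :=
        Finset.sum_le_sum_of_subset_of_nonneg (Finset.filter_subset _ _)
          fun x _ _ => Finset.sum_nonneg fun H _ => g_nonneg H x
    _ = ∑ H with H.Nonempty, ∑ x ∈ {a ∈ s | H ⊆ S a} ×ˢ {a ∈ s | H ⊆ S a}, g H x := by
        refine Finset.sum_comm' fun x H => ?_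
        simp only [Finset.mem_product, Finset.mem_filter, Finset.mem_univ, true_and,
          Finset.subset_inter_iff]
        tauto
    _ = ∑ H with H.Nonempty, (∏ e ∈ H, p e) * (∑ a ∈ s with H ⊆ S a, ∏ e ∈ S a \ H, p e) ^ 2 := by
        refine Finset.sum_congr rfl fun H _ => ?_
        rw [← Finset.mul_sum, Finset.sum_product, sq, Finset.sum_mul_sum]

theorem prod_mul_sq_sum_sdiff_le {κ : Type*} [Fintype κ] [DecidableEq κ] {p : E → ℝ}
    (hp : ∀ e, 0 ≤ p e) (s : Finset ι) (S : ι → Finset E) (c : ι → κ) (H : Finset E) :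
    (∏ e ∈ H, p e) * (∑ a ∈ s with H ⊆ S a, ∏ e ∈ S a \ H, p e) ^ 2 ≤
      Fintype.card κ * ∑ a ∈ s with H ⊆ S a, ∑ b ∈ s with H ⊆ S b ∧ c a = c b,
        (∏ e ∈ S a, p e) * ∏ e ∈ S b \ H, p e := by
  refine (mul_le_mul_of_nonneg_left (sq_sum_le_card_mul_sum_same_label _ c _)
    (Finset.prod_nonneg fun _ _ => hp _)).trans_eq ?_
  rw [mul_left_comm, Finset.mul_sum]
  congr 1
  refine Finset.sum_congr rfl fun a ha => ?_
  rw [Finset.filter_filter, Finset.mul_sum]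
  refine Finset.sum_congr rfl fun b _ => ?_
  rw [← mul_assoc, mul_comm (∏ e ∈ H, p e), Finset.prod_sdiff (Finset.mem_filter.1 ha).2]

end SetSystem

section Cycles

variable {V : Type*} {k : ℕ} [NeZero k]

/-- The `i`-th edge of the closed walk `φ`. -/
def walkEdge (φ : Fin k → V) (i : Fin k) : Sym2 V := s(φ i, φ (i + 1))

theorem add_one_ne_self (hk : 2 ≤ k) (i : Fin k) : i + 1 ≠ i := by
  obtain ⟨m, rfl⟩ := Nat.exists_eq_add_of_le' hk
  simp

theorem add_one_add_one_ne_self (hk : 3 ≤ k) (i : Fin k) : i + 1 + 1 ≠ i := by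
  obtain ⟨m, rfl⟩ := Nat.exists_eq_add_of_le' hk
  rw [add_assoc, Ne, add_eq_left, Fin.ext_iff, Fin.val_add]
  simp [Nat.mod_eq_of_lt]

theorem walkEdge_injective (hk : 3 ≤ k) {φ : Fin k → V} (hφ : Function.Injective φ) :
    Function.Injective (walkEdge φ) := by
  intro i j h
  rcases Sym2.eq_iff.1 h with ⟨h1, _⟩ | ⟨h1, h2⟩
  · exact hφ h1
  · rw [hφ h1] at h2
    exact absurd (hφ h2) (add_one_add_one_ne_self hk j)

variable [DecidableEq V]

/-- The edge set of the closed walk `φ`. -/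
def walkEdges (φ : Fin k → V) : Finset (Sym2 V) := Finset.univ.image (walkEdge φ)

theorem mem_range_of_mem_walkEdges {φ : Fin k → V} {e : Sym2 V} (he : e ∈ walkEdges φ) {v : V}
    (hv : v ∈ e) : v ∈ Set.range φ := by
  obtain ⟨i, -, rfl⟩ := Finset.mem_image.1 he
  rcases Sym2.mem_iff.1 hv with rfl | rfl
  exacts [⟨i, rfl⟩, ⟨i + 1, rfl⟩]

theorem prod_walkEdges {R : Type*} [CommSemiring R] (hk : 3 ≤ k) {φ : Fin k → V}
    (hφ : Function.Injective φ) (p : Sym2 V → R) :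
    ∏ e ∈ walkEdges φ, p e = closedWalkWeight (fun u v => p s(u, v)) φ :=
  Finset.prod_image (walkEdge_injective hk hφ).injOn

theorem prod_walkEdges_sdiff_image {R : Type*} [CommSemiring R] (hk : 3 ≤ k) {φ ψ : Fin k → V}
    (hψ : Function.Injective ψ) {I : Finset (Fin k)} (agree : AgreeOn I φ ψ) (p : Sym2 V → R) :
    ∏ e ∈ walkEdges ψ \ I.image (walkEdge φ), p e = ∏ i ∈ Iᶜ, p s(ψ i, ψ (i + 1)) := by
  have image_eq : I.image (walkEdge φ) = I.image (walkEdge ψ) :=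
    Finset.image_congr fun i hi => by rw [walkEdge, walkEdge, (agree i hi).1, (agree i hi).2]
  have inj := walkEdge_injective hk hψ
  rw [image_eq, walkEdges, ← Finset.image_sdiff _ _ inj, Finset.prod_image inj.injOn,
    ← Finset.compl_eq_univ_sdiff]
  rfl

theorem filter_subset_walkEdges_eq_image [Fintype V] (φ : Fin k → V) :
    ({H | H.Nonempty ∧ H ⊆ walkEdges φ} : Finset (Finset (Sym2 V))) =
      ({I | I.Nonempty} : Finset (Finset (Fin k))).image fun I => I.image (walkEdge φ) := by
  ext H
  simp only [Finset.mem_filter, Finset.mem_univ, true_and, Finset.mem_image]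
  constructor
  · rintro ⟨hne, hsub⟩
    obtain ⟨I, -, rfl⟩ := Finset.subset_image_iff.1 hsub
    exact ⟨I, Finset.image_nonempty.1 hne, rfl⟩
  · rintro ⟨I, hI, rfl⟩
    exact ⟨hI.image _, Finset.image_subset_image (Finset.subset_univ I)⟩

variable (V k) in
/-- The injective closed walks of length `k`: the labelled `k`-cycles of the complete graph. -/
def injWalks [Fintype V] : Finset (Fin k → V) := {φ | Function.Injective φ}

theorem sum_subset_walkEdges_eq_sum_image [Fintype V] {M : Type*} [AddCommMonoid M] (hk : 3 ≤ k)
    (F : Finset (Sym2 V) → (Fin k → V) → M) :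
    ∑ H : Finset (Sym2 V) with H.Nonempty, ∑ φ ∈ injWalks V k with H ⊆ walkEdges φ, F H φ =
      ∑ φ ∈ injWalks V k, ∑ I : Finset (Fin k) with I.Nonempty, F (I.image (walkEdge φ)) φ := by
  calc ∑ H : Finset (Sym2 V) with H.Nonempty, ∑ φ ∈ injWalks V k with H ⊆ walkEdges φ, F H φ
      = ∑ φ ∈ injWalks V k, ∑ H with H.Nonempty ∧ H ⊆ walkEdges φ, F H φ := by
        refine Finset.sum_comm' fun H φ => ?_
        simp only [Finset.mem_filter, Finset.mem_univ, true_and]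
        tauto
    _ = ∑ φ ∈ injWalks V k, ∑ I : Finset (Fin k) with I.Nonempty, F (I.image (walkEdge φ)) φ := by
        refine Finset.sum_congr rfl fun φ hφ => ?_
        have inj := walkEdge_injective hk (Finset.mem_filter.1 hφ).2
        rw [filter_subset_walkEdges_eq_image, Finset.sum_image (Finset.image_injective inj).injOn]

theorem exists_label_of_walkEdges (H : Finset (Sym2 V)) :
    ∃ c : (Fin k → V) → Fin k → Fin k, ∀ φ ψ, Function.Injective φ → H ⊆ walkEdges ψ →
      c φ = c ψ → ∀ i, walkEdge φ i ∈ H → φ i = ψ i ∧ φ (i + 1) = ψ (i + 1) := by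
  -- The label of `φ` records when `φ` visits the vertices of a fixed closed walk through `H`.
  by_cases exists_reference : ∃ θ : Fin k → V, H ⊆ walkEdges θ
  · obtain ⟨θ, hθ⟩ := exists_reference
    refine ⟨fun φ j => Function.invFun φ (θ j), fun φ ψ hφ hψ same_label i hi => ?_⟩
    have same_vertex (l : Fin k) (hl : φ l ∈ walkEdge φ i) : φ l = ψ l := by
      obtain ⟨j, hj⟩ := mem_range_of_mem_walkEdges (hθ hi) hl
      have position : Function.invFun ψ (φ l) = l := by
        rw [← hj, ← show Function.invFun φ (θ j) = Function.invFun ψ (θ j) from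
          congrFun same_label j, hj, Function.leftInverse_invFun hφ l]
      calc φ l = ψ (Function.invFun ψ (φ l)) :=
            (Function.invFun_eq (mem_range_of_mem_walkEdges (hψ hi) hl)).symm
        _ = ψ l := by rw [position]
    exact ⟨same_vertex i (Sym2.mem_mk_left _ _), same_vertex (i + 1) (Sym2.mem_mk_right _ _)⟩
  · exact ⟨fun _ => id, fun _ ψ _ hψ => absurd ⟨ψ, hψ⟩ exists_reference⟩

theorem sum_same_label_le_sum_overlapWeight [Fintype V] {κ : Type*} [DecidableEq κ] (hk : 3 ≤ k)
    {p : Sym2 V → ℝ} (hp : ∀ e, 0 ≤ p e) {φ : Fin k → V} (hφ : Function.Injective φ)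
    (I : Finset (Fin k)) {c : (Fin k → V) → κ}
    (agree : ∀ ψ, I.image (walkEdge φ) ⊆ walkEdges ψ → c φ = c ψ → AgreeOn I φ ψ) :
    ∑ ψ ∈ injWalks V k with I.image (walkEdge φ) ⊆ walkEdges ψ ∧ c φ = c ψ,
        (∏ e ∈ walkEdges φ, p e) * ∏ e ∈ walkEdges ψ \ I.image (walkEdge φ), p e ≤
      ∑ ψ, overlapWeight (fun u v => p s(u, v)) I φ ψ := by
  refine (Finset.sum_le_sum fun ψ hψ => le_of_eq ?_).trans
    (Finset.sum_le_univ_sum_of_nonneg fun ψ => overlapWeight_nonneg (fun _ _ => hp _) I φ ψ)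
  obtain ⟨inj, sub, same⟩ := Finset.mem_filter.1 hψ
  have agree := agree ψ sub same
  rw [overlapWeight, if_pos agree, prod_walkEdges hk hφ,
    prod_walkEdges_sdiff_image hk (Finset.mem_filter.1 inj).2 agree]

theorem sum_prod_union_walkEdges_le [Fintype V] (hk : 3 ≤ k) {p : Sym2 V → ℝ}
    (hp : ∀ e, 0 ≤ p e) :
    ∑ x ∈ injWalks V k ×ˢ injWalks V k with ¬Disjoint (walkEdges x.1) (walkEdges x.2),
        ∏ e ∈ walkEdges x.1 ∪ walkEdges x.2, p e ≤
      k ^ k * ∑ I : Finset (Fin k) with I.Nonempty, overlapSum (fun u v => p s(u, v)) I := by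
  choose c agree using exists_label_of_walkEdges (V := V) (k := k)
  set same : Finset (Sym2 V) → (Fin k → V) → ℝ := fun H φ =>
    ∑ ψ ∈ injWalks V k with H ⊆ walkEdges ψ ∧ c H φ = c H ψ,
      (∏ e ∈ walkEdges φ, p e) * ∏ e ∈ walkEdges ψ \ H, p e
  have same_le (φ : Fin k → V) (hφ : φ ∈ injWalks V k) (I : Finset (Fin k)) :
      same (I.image (walkEdge φ)) φ ≤ ∑ ψ, overlapWeight (fun u v => p s(u, v)) I φ ψ := by
    have hφ : Function.Injective φ := (Finset.mem_filter.1 hφ).2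
    exact sum_same_label_le_sum_overlapWeight hk hp hφ I fun ψ hψ hc i hi =>
      agree _ φ ψ hφ hψ hc i (Finset.mem_image_of_mem _ hi)
  calc ∑ x ∈ injWalks V k ×ˢ injWalks V k with ¬Disjoint (walkEdges x.1) (walkEdges x.2),
        ∏ e ∈ walkEdges x.1 ∪ walkEdges x.2, p e
      ≤ ∑ H : Finset (Sym2 V) with H.Nonempty, (∏ e ∈ H, p e) *
          (∑ φ ∈ injWalks V k with H ⊆ walkEdges φ, ∏ e ∈ walkEdges φ \ H, p e) ^ 2 :=
        sum_prod_union_le hp _ _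
    _ ≤ ∑ H : Finset (Sym2 V) with H.Nonempty,
          k ^ k * ∑ φ ∈ injWalks V k with H ⊆ walkEdges φ, same H φ := by
        refine Finset.sum_le_sum fun H _ => ?_
        simpa using prod_mul_sq_sum_sdiff_le hp (injWalks V k) walkEdges (c H) H
    _ = k ^ k * ∑ φ ∈ injWalks V k, ∑ I : Finset (Fin k) with I.Nonempty,
          same (I.image (walkEdge φ)) φ := by
        rw [← Finset.mul_sum, sum_subset_walkEdges_eq_sum_image hk]
    _ ≤ k ^ k * ∑ φ : Fin k → V, ∑ I : Finset (Fin k) with I.Nonempty,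
          ∑ ψ, overlapWeight (fun u v => p s(u, v)) I φ ψ := by
        refine mul_le_mul_of_nonneg_left ?_ (by positivity)
        refine (Finset.sum_le_sum fun φ hφ =>
          Finset.sum_le_sum fun I _ => same_le φ hφ I).trans ?_
        exact Finset.sum_le_univ_sum_of_nonneg fun φ => Finset.sum_nonneg fun I _ =>
          Finset.sum_nonneg fun ψ _ => overlapWeight_nonneg (fun _ _ => hp _) I φ ψ
    _ = k ^ k * ∑ I : Finset (Fin k) with I.Nonempty, overlapSum (fun u v => p s(u, v)) I := by
        rw [Finset.sum_comm]
        rfl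

end Cycles

theorem closedWalkSum_sub_sum_injWalks_le {V : Type*} [Fintype V] [DecidableEq V] {k : ℕ}
    [NeZero k] {w : V → V → ℝ} (hw : ∀ u v, 0 ≤ w u v) :
    closedWalkSum k w - ∑ φ ∈ injWalks V k, closedWalkWeight w φ ≤
      ∑ x ∈ (Finset.univ : Finset (Fin k)).offDiag, coincidenceSum w x.1 x.2 := by
  have weight_nonneg := closedWalkWeight_nonneg (k := k) hw
  rw [closedWalkSum, injWalks, ← Finset.sum_filter_add_sum_filter_not _ Function.Injective,
    add_sub_cancel_left]
  calc ∑ φ : Fin k → V with ¬Function.Injective φ, closedWalkWeight w φ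
      ≤ ∑ φ : Fin k → V with ¬Function.Injective φ,
          ∑ x ∈ Finset.univ.offDiag with φ x.1 = φ x.2, closedWalkWeight w φ := by
        refine Finset.sum_le_sum fun φ hφ => ?_
        obtain ⟨i, j, heq, hne⟩ := Function.not_injective_iff.1 (Finset.mem_filter.1 hφ).2
        exact Finset.single_le_sum (f := fun _ => closedWalkWeight w φ)
          (fun _ _ => weight_nonneg φ) (a := (i, j)) (by simp [hne, heq])
    _ ≤ ∑ φ : Fin k → V, ∑ x ∈ Finset.univ.offDiag with φ x.1 = φ x.2, closedWalkWeight w φ :=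
        Finset.sum_le_univ_sum_of_nonneg fun φ => Finset.sum_nonneg fun _ _ => weight_nonneg φ
    _ = ∑ x ∈ (Finset.univ : Finset (Fin k)).offDiag, coincidenceSum w x.1 x.2 :=
        Finset.sum_comm' fun φ x => by simp [and_comm]

theorem sum_injWalks_le_closedWalkSum_pow {V : Type*} [Fintype V] [DecidableEq V] {k : ℕ}
    [NeZero k] {w : V → V → ℝ} (hw : ∀ u v, 0 ≤ w u v) (n : ℕ) :
    ∑ φ ∈ injWalks (Fin n → V) k, closedWalkWeight (tensorPower w n) φ ≤ closedWalkSum k w ^ n := by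
  rw [← closedWalkSum_tensorPower]
  exact Finset.sum_le_univ_sum_of_nonneg
    (closedWalkWeight_nonneg fun _ _ => Finset.prod_nonneg fun _ _ => hw _ _)

theorem tendsto_sum_injWalks_div_closedWalkSum_pow {V : Type*} [Fintype V] [DecidableEq V]
    [Nontrivial V] {k : ℕ} [NeZero k] {w : V → V → ℝ} (hw : ∀ u v, 0 < w u v) :
    Tendsto (fun n => (∑ φ ∈ injWalks (Fin n → V) k, closedWalkWeight (tensorPower w n) φ) /
      closedWalkSum k w ^ n) atTop (𝓝 1) := by
  have walkSum_pos : 0 < closedWalkSum k w :=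
    Finset.sum_pos (fun φ _ => Finset.prod_pos fun _ _ => hw _ _) Finset.univ_nonempty
  have tensor_nonneg (n : ℕ) (u v : Fin n → V) : 0 ≤ tensorPower w n u v :=
    Finset.prod_nonneg fun _ _ => (hw _ _).le
  have coincidence_negligible :
      Tendsto (fun n => ∑ x ∈ (Finset.univ : Finset (Fin k)).offDiag,
        (coincidenceSum w x.1 x.2 / closedWalkSum k w) ^ n) atTop (𝓝 0) := by
    rw [← Finset.sum_const_zero (ι := Fin k × Fin k) (s := Finset.univ.offDiag)]
    refine tendsto_finsetSum _ fun x hx => tendsto_pow_atTop_nhds_zero_of_lt_one ?_ ?_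
    · exact div_nonneg (Finset.sum_nonneg fun φ _ =>
        closedWalkWeight_nonneg (fun u v => (hw u v).le) φ) walkSum_pos.le
    · exact (div_lt_one walkSum_pos).2
        (coincidenceSum_lt_closedWalkSum hw (Finset.mem_offDiag.1 hx).2.2)
  refine tendsto_of_tendsto_of_tendsto_of_le_of_le
    (by simpa using coincidence_negligible.const_sub 1) tendsto_const_nhds (fun n => ?_) fun n => ?_
  · have missing := closedWalkSum_sub_sum_injWalks_le (k := k) (tensor_nonneg n)
    simp only [closedWalkSum_tensorPower, coincidenceSum_tensorPower] at missing
    rw [le_div_iff₀ (pow_pos walkSum_pos n), sub_mul, one_mul, Finset.sum_mul]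
    simp only [div_pow, div_mul_cancel₀ _ (pow_pos walkSum_pos n).ne']
    linarith
  · rw [div_le_one (pow_pos walkSum_pos n)]
    exact sum_injWalks_le_closedWalkSum_pow (fun u v => (hw u v).le) n

theorem isProbabilityMeasure_bernoulliLaw {p : ℝ} (hp : p ∈ Set.Icc 0 1) :
    IsProbabilityMeasure (bernoulliLaw p) := by
  constructor
  simp [bernoulliLaw, ← ENNReal.ofReal_add hp.1 (sub_nonneg.2 hp.2)]

/-- The law of a random subset of `E` that contains each `e` with probability `p e`, independently.
A subset is encoded as a predicate. -/
noncomputable def randomSubsetLaw {E : Type*} [Fintype E] (p : E → ℝ) : Measure (E → Prop) :=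
  Measure.pi fun e => bernoulliLaw (p e)

theorem isProbabilityMeasure_randomSubsetLaw {E : Type*} [Fintype E] {p : E → ℝ}
    (hp : ∀ e, p e ∈ Set.Icc 0 1) : IsProbabilityMeasure (randomSubsetLaw p) := by
  have := fun e => isProbabilityMeasure_bernoulliLaw (hp e)
  unfold randomSubsetLaw
  infer_instance

theorem randomSubsetLaw_real_forall_mem {E : Type*} [Fintype E] {p : E → ℝ}
    (hp : ∀ e, p e ∈ Set.Icc 0 1) (s : Finset E) :
    (randomSubsetLaw p).real {ω | ∀ e ∈ s, ω e} = ∏ e ∈ s, p e := by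
  classical
  have := fun e => isProbabilityMeasure_bernoulliLaw (hp e)
  have factor (e : E) : (bernoulliLaw (p e)).real (if e ∈ s then {True} else Set.univ) =
      if e ∈ s then p e else 1 := by
    split_ifs
    · simp [bernoulliLaw, measureReal_def, (hp e).1]
    · exact probReal_univ
  have box : {ω : E → Prop | ∀ e ∈ s, ω e} =
      Set.univ.pi fun e => if e ∈ s then {True} else Set.univ := by
    ext ω
    refine forall_congr' fun e => ?_
    by_cases he : e ∈ s <;> simp [he]
  rw [box, randomSubsetLaw, measureReal_def, Measure.pi_pi, ENNReal.toReal_prod]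
  simp_rw [← measureReal_def, factor]
  rw [Finset.prod_ite_mem, Finset.univ_inter]

section SubsetCount

variable {ι E : Type*}

/-- The number of indices in `s` whose set `S a` is contained in the set `ω`. -/
noncomputable def subsetCount (s : Finset ι) (S : ι → Finset E) (ω : E → Prop) : ℝ :=
  ∑ a ∈ s, {ω : E → Prop | ∀ e ∈ S a, ω e}.indicator 1 ω

variable [Fintype E] {p : E → ℝ} (hp : ∀ e, p e ∈ Set.Icc 0 1) (s : Finset ι) (S : ι → Finset E)
include hp

theorem integral_subsetCount :
    ∫ ω, subsetCount s S ω ∂randomSubsetLaw p = ∑ a ∈ s, ∏ e ∈ S a, p e := by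
  have := isProbabilityMeasure_randomSubsetLaw hp
  unfold subsetCount
  rw [integral_finsetSum _ fun _ _ => Integrable.of_finite]
  refine Finset.sum_congr rfl fun a _ => ?_
  rw [integral_indicator_one (Set.toFinite _).measurableSet, randomSubsetLaw_real_forall_mem hp]

variable [DecidableEq E]

theorem integral_sq_subsetCount :
    ∫ ω, subsetCount s S ω ^ 2 ∂randomSubsetLaw p =
      ∑ x ∈ s ×ˢ s, ∏ e ∈ S x.1 ∪ S x.2, p e := by
  have sq_eq (ω : E → Prop) :
      subsetCount s S ω ^ 2 = subsetCount (s ×ˢ s) (fun x => S x.1 ∪ S x.2) ω := by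
    rw [subsetCount, subsetCount, sq, Finset.sum_mul_sum, Finset.sum_product]
    refine Finset.sum_congr rfl fun a _ => Finset.sum_congr rfl fun b _ => ?_
    have inter_eq : {ω : E → Prop | ∀ e ∈ S a ∪ S b, ω e} =
        {ω | ∀ e ∈ S a, ω e} ∩ {ω | ∀ e ∈ S b, ω e} := by
      ext ω
      exact Finset.forall_mem_union
    rw [inter_eq, Set.inter_indicator_one, Pi.mul_apply]
  simp_rw [sq_eq, integral_subsetCount hp]

theorem variance_subsetCount_le :
    ProbabilityTheory.variance (subsetCount s S) (randomSubsetLaw p) ≤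
      ∑ x ∈ s ×ˢ s with ¬Disjoint (S x.1) (S x.2), ∏ e ∈ S x.1 ∪ S x.2, p e := by
  have := isProbabilityMeasure_randomSubsetLaw hp
  have prod_nonneg (T : Finset E) : 0 ≤ ∏ e ∈ T, p e := Finset.prod_nonneg fun e _ => (hp e).1
  rw [ProbabilityTheory.variance_eq_sub .of_discrete, Finset.sum_filter]
  simp only [Pi.pow_apply]
  rw [integral_sq_subsetCount hp, integral_subsetCount hp, sq (∑ a ∈ s, _), Finset.sum_mul_sum,
    ← Finset.sum_product', ← Finset.sum_sub_distrib]
  refine Finset.sum_le_sum fun x _ => ?_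
  split_ifs with meet
  · rw [Finset.prod_union meet, sub_self]
  · exact sub_le_self _ (mul_nonneg (prod_nonneg _) (prod_nonneg _))

end SubsetCount

theorem cycleGraph_adj_iff {k : ℕ} [NeZero k] (hk : 2 ≤ k) {i j : Fin k} :
    (SimpleGraph.cycleGraph k).Adj i j ↔ j = i + 1 ∨ i = j + 1 := by
  obtain ⟨m, rfl⟩ := Nat.exists_eq_add_of_le' hk
  rw [SimpleGraph.cycleGraph_adj, sub_eq_iff_eq_add', sub_eq_iff_eq_add']
  exact or_comm

section CycleCopies

variable {V : Type*} [DecidableEq V] {k : ℕ} [NeZero k]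

theorem forall_adj_cycleGraph_iff (hk : 2 ≤ k) {φ : Fin k → V} (hφ : Function.Injective φ)
    (ω : Sym2 V → Prop) :
    (∀ i j, (SimpleGraph.cycleGraph k).Adj i j →
      (SimpleGraph.fromEdgeSet {e | ω e}).Adj (φ i) (φ j)) ↔ ∀ e ∈ walkEdges φ, ω e := by
  have step_adj (i : Fin k) :
      (SimpleGraph.fromEdgeSet {e | ω e}).Adj (φ i) (φ (i + 1)) ↔ ω (walkEdge φ i) := by
    rw [SimpleGraph.fromEdgeSet_adj]
    exact and_iff_left (hφ.ne (add_one_ne_self hk i).symm)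
  simp only [walkEdges, Finset.forall_mem_image, Finset.mem_univ, true_imp_iff, ← step_adj,
    cycleGraph_adj_iff hk]
  refine ⟨fun h i => h i _ (Or.inl rfl), fun h i j hij => ?_⟩
  rcases hij with rfl | rfl
  exacts [@h _, (@h _).symm]

theorem labelledCopyCount_cycleGraph_fromEdgeSet [Fintype V] (hk : 2 ≤ k) (ω : Sym2 V → Prop) :
    ((SimpleGraph.fromEdgeSet {e | ω e}).labelledCopyCount (SimpleGraph.cycleGraph k) : ℝ) =
      subsetCount (injWalks V k) walkEdges ω := by
  classical
  let copyEquiv : SimpleGraph.Copy (SimpleGraph.cycleGraph k) (SimpleGraph.fromEdgeSet {e | ω e}) ≃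
      {φ : Fin k → V // Function.Injective φ ∧ ∀ e ∈ walkEdges φ, ω e} :=
    { toFun c := ⟨c, c.injective,
        (forall_adj_cycleGraph_iff hk c.injective ω).1 fun _ _ h => c.toHom.map_adj h⟩
      invFun φ := ⟨⟨φ.1, fun {i j} => (forall_adj_cycleGraph_iff hk φ.2.1 ω).2 φ.2.2 i j⟩, φ.2.1⟩ }
  rw [SimpleGraph.labelledCopyCount, Fintype.card_eq_nat_card, Nat.card_congr copyEquiv,
    Nat.card_eq_fintype_card, Fintype.card_subtype, Finset.natCast_card_filter, subsetCount,
    injWalks, Finset.sum_filter]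
  refine Finset.sum_congr rfl fun φ _ => ?_
  simp [Set.indicator_apply, ite_and]

end CycleCopies

theorem measureReal_lt_abs_sub_le {Ω : Type*} [MeasurableSpace Ω] {μ : Measure Ω}
    [IsProbabilityMeasure μ] {X : Ω → ℝ} (hX : MemLp X 2 μ) (m : ℝ) {c : ℝ} (hc : 0 < c) :
    μ.real {ω | c < |X ω - m|} ≤
      (ProbabilityTheory.variance X μ + (∫ ω, X ω ∂μ - m) ^ 2) / c ^ 2 := by
  have centred : MemLp (fun ω => X ω - m) 2 μ := hX.sub (memLp_const m)
  have second_moment : ∫ ω, (X ω - m) ^ 2 ∂μ =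
      ProbabilityTheory.variance X μ + (∫ ω, X ω ∂μ - m) ^ 2 := by
    rw [← ProbabilityTheory.variance_sub_const hX.aestronglyMeasurable m,
      ProbabilityTheory.variance_eq_sub centred,
      integral_sub (hX.integrable one_le_two) (integrable_const m)]
    simp
  rw [le_div_iff₀' (pow_pos hc 2), ← second_moment]
  calc c ^ 2 * μ.real {ω | c < |X ω - m|}
      ≤ c ^ 2 * μ.real {ω | c ^ 2 ≤ (X ω - m) ^ 2} := by
        refine mul_le_mul_of_nonneg_left (measureReal_mono fun ω hω => ?_) (sq_nonneg c)
        exact sq_le_sq.2 ((abs_of_pos hc).trans_le (le_of_lt hω))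
    _ ≤ ∫ ω, (X ω - m) ^ 2 ∂μ := mul_meas_ge_le_integral_of_nonneg
        (Eventually.of_forall fun ω => sq_nonneg (X ω - m)) centred.integrable_sq (c ^ 2)

theorem tendsto_measureReal_lt_abs_sub {ι : Type*} {l : Filter ι} {Ω : ι → Type*}
    [∀ n, MeasurableSpace (Ω n)] {μ : ∀ n, Measure (Ω n)} [∀ n, IsProbabilityMeasure (μ n)]
    {X : ∀ n, Ω n → ℝ} (hX : ∀ n, MemLp (X n) 2 (μ n)) {m : ι → ℝ} (hm : ∀ n, 0 < m n)
    (mean : Tendsto (fun n => (∫ ω, X n ω ∂μ n) / m n) l (𝓝 1))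
    (variance : Tendsto (fun n => ProbabilityTheory.variance (X n) (μ n) / m n ^ 2) l (𝓝 0))
    {ε : ℝ} (hε : 0 < ε) :
    Tendsto (fun n => (μ n).real {ω | ε * m n < |X n ω - m n|}) l (𝓝 0) := by
  have relative_error : Tendsto (fun n =>
      (ProbabilityTheory.variance (X n) (μ n) / m n ^ 2 +
        ((∫ ω, X n ω ∂μ n) / m n - 1) ^ 2) / ε ^ 2) l (𝓝 0) := by
    simpa using (variance.add ((mean.sub_const 1).pow 2)).div_const (ε ^ 2)
  refine squeeze_zero (fun _ => measureReal_nonneg) (fun n => ?_) relative_error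
  refine (measureReal_lt_abs_sub_le (hX n) (m n) (mul_pos hε (hm n))).trans_eq ?_
  have := (hm n).ne'
  field_simp

theorem kroneckerProb_mk (α β γ : ℝ) (n : ℕ) (u v : BinString n) :
    kroneckerProb α β γ n s(u, v) = tensorPower (kroneckerMatrix α β γ) n u v :=
  rfl

section Kronecker

variable {α β γ : ℝ} (hα : α ∈ Set.Icc 0 1) (hβ : β ∈ Set.Icc 0 1) (hγ : γ ∈ Set.Icc 0 1)
include hα hβ hγ

theorem kroneckerProb_mem_Icc (n : ℕ) (e : Sym2 (BinString n)) :
    kroneckerProb α β γ n e ∈ Set.Icc 0 1 := by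
  induction e with
  | _ u v =>
    have digit (l : Fin n) := kroneckerMatrix_mem_of_mem hα hβ hγ (u l) (v l)
    rw [kroneckerProb_mk]
    exact ⟨Finset.prod_nonneg fun l _ => (digit l).1,
      Finset.prod_le_one (fun l _ => (digit l).1) fun l _ => (digit l).2⟩

theorem isProbabilityMeasure_stochasticKronecker (n : ℕ) :
    IsProbabilityMeasure (stochasticKronecker α β γ n) := by
  have := isProbabilityMeasure_randomSubsetLaw (kroneckerProb_mem_Icc hα hβ hγ n)
  exact Measure.isProbabilityMeasure_map (μ := randomSubsetLaw (kroneckerProb α β γ n))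
    (measurable_of_finite _).aemeasurable

theorem KroneckerAas.mono {Q R : ∀ n : ℕ, SimpleGraph (BinString n) → Prop}
    (hQ : KroneckerAas α β γ Q) (hQR : ∀ n G, Q n G → R n G) : KroneckerAas α β γ R := by
  refine tendsto_of_tendsto_of_tendsto_of_le_of_le hQ tendsto_const_nhds
    (fun n => measure_mono (hQR n)) fun n => ?_
  have := isProbabilityMeasure_stochasticKronecker hα hβ hγ n
  exact prob_le_one

theorem kroneckerAas_of_tendsto_failure {Q : ∀ n : ℕ, SimpleGraph (BinString n) → Prop}
    (failure : Tendsto (fun n => (randomSubsetLaw (kroneckerProb α β γ n)).real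
      {ω | ¬Q n (SimpleGraph.fromEdgeSet {e | ω e})}) atTop (𝓝 0)) :
    KroneckerAas α β γ Q := by
  have le_prob (n : ℕ) :
      ENNReal.ofReal (1 - (randomSubsetLaw (kroneckerProb α β γ n)).real
        {ω | ¬Q n (SimpleGraph.fromEdgeSet {e | ω e})}) ≤
      stochasticKronecker α β γ n {G | Q n G} := by
    have := isProbabilityMeasure_randomSubsetLaw (kroneckerProb_mem_Icc hα hβ hγ n)
    rw [← probReal_compl_eq_one_sub (Set.toFinite _).measurableSet, ofReal_measureReal]
    refine (measure_mono fun ω hω => ?_).trans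
      (Measure.le_map_apply (measurable_of_finite _).aemeasurable _)
    exact not_not.1 hω
  have prob_le_one (n : ℕ) : stochasticKronecker α β γ n {G | Q n G} ≤ 1 := by
    have := isProbabilityMeasure_stochasticKronecker hα hβ hγ n
    exact prob_le_one
  refine tendsto_of_tendsto_of_tendsto_of_le_of_le ?_ tendsto_const_nhds le_prob prob_le_one
  simpa using ENNReal.tendsto_ofReal (failure.const_sub 1)

variable {k : ℕ} [NeZero k] (hk : 3 ≤ k)
include hk

theorem integral_cycleCount_kronecker (n : ℕ) :
    ∫ ω, subsetCount (injWalks (BinString n) k) walkEdges ω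
        ∂randomSubsetLaw (kroneckerProb α β γ n) =
      ∑ φ ∈ injWalks (BinString n) k,
        closedWalkWeight (tensorPower (kroneckerMatrix α β γ) n) φ := by
  rw [integral_subsetCount (kroneckerProb_mem_Icc hα hβ hγ n)]
  exact Finset.sum_congr rfl fun φ hφ => prod_walkEdges hk (Finset.mem_filter.1 hφ).2 _

theorem variance_cycleCount_kronecker_le (n : ℕ) :
    ProbabilityTheory.variance (subsetCount (injWalks (BinString n) k) walkEdges)
        (randomSubsetLaw (kroneckerProb α β γ n)) ≤
      k ^ k * ∑ I : Finset (Fin k) with I.Nonempty, overlapSum (kroneckerMatrix α β γ) I ^ n := by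
  have hp := kroneckerProb_mem_Icc hα hβ hγ n
  have overlap_eq (I : Finset (Fin k)) :
      overlapSum (fun u v => kroneckerProb α β γ n s(u, v)) I =
        overlapSum (kroneckerMatrix α β γ) I ^ n :=
    overlapSum_tensorPower _ n I
  simp_rw [← overlap_eq]
  exact (variance_subsetCount_le hp _ _).trans (sum_prod_union_walkEdges_le hk fun e => (hp e).1)

theorem kroneckerAas_not_isContained_cycleGraph
    (subcritical : closedWalkSum k (kroneckerMatrix α β γ) < 1) :
    KroneckerAas α β γ fun _ G => ¬(SimpleGraph.cycleGraph k).IsContained G := by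
  have entry_nonneg (a b : ZMod 2) := (kroneckerMatrix_mem_of_mem hα hβ hγ a b).1
  have walkSum_nonneg : 0 ≤ closedWalkSum k (kroneckerMatrix α β γ) :=
    Finset.sum_nonneg fun φ _ => closedWalkWeight_nonneg entry_nonneg φ
  refine kroneckerAas_of_tendsto_failure hα hβ hγ (squeeze_zero (fun _ => measureReal_nonneg)
    (fun n => ?_) (tendsto_pow_atTop_nhds_zero_of_lt_one walkSum_nonneg subcritical))
  have := isProbabilityMeasure_randomSubsetLaw (kroneckerProb_mem_Icc hα hβ hγ n)
  set μ := randomSubsetLaw (kroneckerProb α β γ n)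
  set X := subsetCount (injWalks (BinString n) k) walkEdges
  have X_nonneg (ω : Sym2 (BinString n) → Prop) : 0 ≤ X ω :=
    Finset.sum_nonneg fun _ _ => Set.indicator_nonneg (fun _ _ => zero_le_one) ω
  calc μ.real {ω | ¬¬(SimpleGraph.cycleGraph k).IsContained (SimpleGraph.fromEdgeSet {e | ω e})}
      ≤ μ.real {ω | 1 ≤ X ω} := by
        refine measureReal_mono fun ω hω => ?_
        have one_copy := SimpleGraph.labelledCopyCount_pos.2 (not_not.1 hω)
        exact (Nat.one_le_cast.2 one_copy).trans_eq
          (labelledCopyCount_cycleGraph_fromEdgeSet (by lia) ω)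
    _ ≤ ∫ ω, X ω ∂μ := by
        simpa using mul_meas_ge_le_integral_of_nonneg (Eventually.of_forall X_nonneg)
          Integrable.of_finite 1
    _ = ∑ φ ∈ injWalks (BinString n) k, closedWalkWeight (tensorPower _ n) φ :=
        integral_cycleCount_kronecker hα hβ hγ hk n
    _ ≤ closedWalkSum k (kroneckerMatrix α β γ) ^ n :=
        sum_injWalks_le_closedWalkSum_pow entry_nonneg n

theorem tendsto_variance_cycleCount_kronecker_div
    (walkSum_pos : 0 < closedWalkSum k (kroneckerMatrix α β γ))
    (overlap_lt : ∀ I : Finset (Fin k), I.Nonempty →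
      overlapSum (kroneckerMatrix α β γ) I < closedWalkSum k (kroneckerMatrix α β γ) ^ 2) :
    Tendsto (fun n => ProbabilityTheory.variance (subsetCount (injWalks (BinString n) k) walkEdges)
      (randomSubsetLaw (kroneckerProb α β γ n)) /
        (closedWalkSum k (kroneckerMatrix α β γ) ^ n) ^ 2) atTop (𝓝 0) := by
  have entry_nonneg (a b : ZMod 2) := (kroneckerMatrix_mem_of_mem hα hβ hγ a b).1
  have overlap_nonneg (I : Finset (Fin k)) : 0 ≤ overlapSum (kroneckerMatrix α β γ) I :=
    Finset.sum_nonneg fun φ _ => Finset.sum_nonneg fun ψ _ =>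
      overlapWeight_nonneg entry_nonneg I φ ψ
  have overlap_negligible : Tendsto (fun n => (k ^ k : ℝ) * ∑ I : Finset (Fin k) with I.Nonempty,
      (overlapSum (kroneckerMatrix α β γ) I / closedWalkSum k (kroneckerMatrix α β γ) ^ 2) ^ n)
      atTop (𝓝 0) := by
    rw [← mul_zero (k ^ k : ℝ), ← Finset.sum_const_zero (s := {I : Finset (Fin k) | I.Nonempty})]
    refine (tendsto_finsetSum _ fun I hI => tendsto_pow_atTop_nhds_zero_of_lt_one
      (div_nonneg (overlap_nonneg I) (sq_nonneg _)) ?_).const_mul _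
    exact (div_lt_one (pow_pos walkSum_pos 2)).2 (overlap_lt I (Finset.mem_filter.1 hI).2)
  refine squeeze_zero (fun n => div_nonneg (ProbabilityTheory.variance_nonneg _ _) (sq_nonneg _))
    (fun n => ?_) overlap_negligible
  have norm_pos : 0 < (closedWalkSum k (kroneckerMatrix α β γ) ^ n) ^ 2 :=
    pow_pos (pow_pos walkSum_pos n) 2
  refine (div_le_div_of_nonneg_right (variance_cycleCount_kronecker_le hα hβ hγ hk n)
    norm_pos.le).trans_eq ?_
  simp only [div_pow, ← pow_mul, mul_comm 2 n, mul_div_assoc, Finset.sum_div]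

end Kronecker

theorem kroneckerAas_abs_labelledCopyCount_cycleGraph_sub_le {α β γ : ℝ} (hα : α ∈ Set.Ioc 0 1)
    (hβ : β ∈ Set.Ioc 0 1) (hγ : γ ∈ Set.Ioc 0 1) {k : ℕ} [NeZero k] (hk : 3 ≤ k)
    (overlap_lt : ∀ I : Finset (Fin k), I.Nonempty →
      overlapSum (kroneckerMatrix α β γ) I < closedWalkSum k (kroneckerMatrix α β γ) ^ 2)
    {ε : ℝ} (hε : 0 < ε) :
    KroneckerAas α β γ fun n G =>
      |(G.labelledCopyCount (SimpleGraph.cycleGraph k) : ℝ) -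
        closedWalkSum k (kroneckerMatrix α β γ) ^ n| ≤
          ε * closedWalkSum k (kroneckerMatrix α β γ) ^ n := by
  have entry_pos (a b : ZMod 2) := (kroneckerMatrix_mem_of_mem hα hβ hγ a b).1
  have walkSum_pos : 0 < closedWalkSum k (kroneckerMatrix α β γ) :=
    Finset.sum_pos (fun φ _ => Finset.prod_pos fun _ _ => entry_pos _ _) Finset.univ_nonempty
  replace hα := Set.Ioc_subset_Icc_self hα
  replace hβ := Set.Ioc_subset_Icc_self hβ
  replace hγ := Set.Ioc_subset_Icc_self hγ
  have (n : ℕ) := isProbabilityMeasure_randomSubsetLaw (kroneckerProb_mem_Icc hα hβ hγ n)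
  have mean_ratio : Tendsto (fun n => (∫ ω, subsetCount (injWalks (BinString n) k) walkEdges ω
      ∂randomSubsetLaw (kroneckerProb α β γ n)) / closedWalkSum k (kroneckerMatrix α β γ) ^ n)
      atTop (𝓝 1) := by
    simp_rw [integral_cycleCount_kronecker hα hβ hγ hk]
    exact tendsto_sum_injWalks_div_closedWalkSum_pow entry_pos
  have concentration := tendsto_measureReal_lt_abs_sub (fun n => MemLp.of_discrete)
    (fun n => pow_pos walkSum_pos n) mean_ratio
    (tendsto_variance_cycleCount_kronecker_div hα hβ hγ hk walkSum_pos overlap_lt) hε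
  refine kroneckerAas_of_tendsto_failure hα hβ hγ ?_
  simpa only [labelledCopyCount_cycleGraph_fromEdgeSet (show 2 ≤ k by lia), not_le]
    using concentration

theorem theorem3 (k : ℕ) (hk : 3 ≤ k) (α β γ : ℝ)
    (hα : 0 < α ∧ α < 1) (hβ : 0 < β ∧ β < 1) (hγ : 0 < γ ∧ γ < 1) (hαγ : α = γ) :
    ((α + β) ^ k + (α - β) ^ k < 1 →
      KroneckerAas α β γ fun _ G => ¬ (SimpleGraph.cycleGraph k).IsContained G) ∧
    ((α + β) ^ k + (α - β) ^ k > 1 →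
      KroneckerAas α β γ fun _ G => (SimpleGraph.cycleGraph k).IsContained G) ∧
    ((α + β) ^ k + (α - β) ^ k > 1 → ∀ ε : ℝ, 0 < ε →
      KroneckerAas α β γ fun n G =>
        |(G.labelledCopyCount (SimpleGraph.cycleGraph k) : ℝ)
            - ((α + β) ^ k + (α - β) ^ k) ^ n|
          ≤ ε * ((α + β) ^ k + (α - β) ^ k) ^ n) := by
  subst hαγ
  have : NeZero k := ⟨by lia⟩
  have hα' : α ∈ Set.Ioc 0 1 := Set.Ioo_subset_Ioc_self hα
  have hβ' : β ∈ Set.Ioc 0 1 := Set.Ioo_subset_Ioc_self hβ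
  have hα'' : α ∈ Set.Icc 0 1 := Set.Ioo_subset_Icc_self hα
  have hβ'' : β ∈ Set.Icc 0 1 := Set.Ioo_subset_Icc_self hβ
  rw [← closedWalkSum_kroneckerMatrix]
  have concentration (supercritical : 1 < closedWalkSum k (kroneckerMatrix α β α)) {ε : ℝ} :=
    kroneckerAas_abs_labelledCopyCount_cycleGraph_sub_le (ε := ε) hα' hβ' hα' hk fun I hI =>
      overlapSum_kroneckerMatrix_lt hα.1 hβ'.1.le hβ'.2 supercritical hI
  refine ⟨kroneckerAas_not_isContained_cycleGraph hα'' hβ'' hα'' hk, fun supercritical => ?_,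
    fun supercritical ε hε => concentration supercritical hε⟩
  refine (concentration supercritical one_half_pos).mono hα'' hβ'' hα'' fun n G hG => ?_
  have expected_pos : 0 < closedWalkSum k (kroneckerMatrix α β α) ^ n :=
    pow_pos (zero_lt_one.trans supercritical) n
  have count_pos : (0 : ℝ) < G.labelledCopyCount (SimpleGraph.cycleGraph k) := by
    linarith [(abs_le.1 hG).1]
  exact SimpleGraph.labelledCopyCount_pos.1 (Nat.cast_pos.1 count_pos)
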